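/- Let $k\ge 1$ and $q\ge 0$ be integers. Let $R_{k,q}=\{x\in\mathbb R^{k-1}: 0\le x_1\le\cdots\le x_{k-1}\le q\}$ and $W_{k,q}=R_{k,q}\cap\mathbb Z^{k-1}$. For $v\in W_{k,q}$ with $v+(1,\dots,1)\in W_{k,q}$ and a permutation $\pi=\pi_1\cdots\pi_{k-1}$ of $\{1,\dots,k-1\}$ in which $i$ stands before $i+1$ whenever $v_i=v_{i+1}$, let $F(v,\pi)$ be the simplex with vertices $v,\ v+e_{\pi_{k-1}},\ v+e_{\pi_{k-1}}+e_{\pi_{k-2}},\ \dots,\ v+e_{\pi_{k-1}}+\cdots+e_{\pi_1}$. The edgewise subdivision $T_{k,q}$ of $R_{k,q}$ is the simplicial complex whose facets are these simplices. The star cluster $SC(F)$ of a face $F$ is the union of the closed stars in $T_{k,q}$ of the vertices of $F$. The $h$-vector $(h_0,\dots,h_{d+1})$ of a $d$-dimensional complex with $f_{i-1}$ faces on $i$ vertices ($f_{-1}=1$) is $h_s=\sum_{i=0}^s(-1)^{s-i}\binom{d+1-i}{d+1-s}f_{i-1}$. For a permutation $\pi\in\mathbb S_k$ let $\mathrm{des}(\pi)$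 be its number of descents and $\mathrm{init}(\pi)=\min\{t\ge 1:\{\pi_1,\dots,\pi_t\}=\{1,\dots,t\}\}$. Let $H_k=[h^k_{i,d}]_{1\le i,d\le k}$, where $h^k_{i,d}$ is the number of $\pi\in\mathbb S_k$ with $\mathrm{init}(\pi)=i$ and $\mathrm{des}(\pi)=d-1$, and let $\mathbf h^k_i=(h^k_{i,1},\dots,h^k_{i,k})$ be its $i$-th row. **Theorem.** Let $F=F(v,\mathrm{Id})$ be a facet of $T_{k,q}$ all of whose vertices lie in the interior of $R_{k,q}$. Then $SC(F)$ has dimension $k-1$, $h_k(SC(F))=0$, and $$\big(h_0(SC(F)),\dots,h_{k-1}(SC(F))\big)=(1,2,\dots,k)\,H_k=\sum_{i=1}^k i\cdot\mathbf h^k_i=k\cdot\mathbf h\big(Sd(\partial\Delta^{k-1})\big)-\sum_{i=1}^{k-1}(k-i)\cdot\mathbf h^k_i,$$ where $Sd(\partial\Delta^{k-1})$, a complex of dimension $k-2$, is the barycentric subdivision of the boundary of the $(k-1)$-simplex. Equivalently, for all $0\le j\le k$, $$h_j(SC(F))=\sum_{\pi\in\mathbb S_k,\ \mathrm{des}(\pi)=j}\mathrm{init}(\pi).$$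 -/

import Mathlib

open scoped Matrix

noncomputable section

namespace EdgewiseSubdivision

/-! ### Simplicial complexes: dimension, `f`- and `h`-vector, star, star cluster, subdivision -/

section Complexes

variable {ι : Type*}

/-- The number `d + 1`, where `d` is the dimension of the finite complex `K`: the largest number of
vertices of a face. It is `0` if the empty face is the only face. -/
def rank (K : PreAbstractSimplicialComplex ι) : ℕ :=
  sSup (Finset.card '' K.faces)

/-- `fNum K i` is `f_{i-1}`, the number of faces of `K` with exactly `i` vertices. Mathlib's
complexes do not list the empty face, so `f_{-1} = 1` is put in by hand. -/
def fNum (K : PreAbstractSimplicialComplex ι) (i : ℕ) : ℕ :=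
  if i = 0 then 1 else Set.ncard {s | s ∈ K.faces ∧ s.card = i}

/-- The entry `h_s` (`0 ≤ s ≤ d + 1`) of the `h`-vector of a `d`-dimensional complex,
`h_s = ∑_{i ≤ s} (-1)^(s-i) * C(d+1-i, d+1-s) * f_{i-1}`; extended by `0` to `s > d + 1`. -/
def hNum (K : PreAbstractSimplicialComplex ι) (s : ℕ) : ℤ :=
  if s ≤ rank K then
    ∑ i ∈ Finset.range (s + 1),
      (-1) ^ (s - i) * ((rank K - i).choose (rank K - s) : ℤ) * (fNum K i : ℤ)
  else 0

/-- The (closed) star of `σ` in `K`: all faces of the faces of `K` that contain `σ`. -/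
def star (K : PreAbstractSimplicialComplex ι) (σ : Finset ι) : PreAbstractSimplicialComplex ι where
  faces := {ρ | ρ.Nonempty ∧ ∃ τ ∈ K.faces, σ ⊆ τ ∧ ρ ⊆ τ}
  isRelLowerSet_faces := by
    rintro ρ ⟨hρ, τ, hτ, hσ, hρτ⟩
    exact ⟨hρ, fun _ hsub hne => ⟨hne, τ, hτ, hσ, subset_trans hsub hρτ⟩⟩

/-- The star cluster of `σ` in `K`: the union of the stars of the vertices of `σ`. -/
def starCluster (K : PreAbstractSimplicialComplex ι) (σ : Finset ι) :
    PreAbstractSimplicialComplex ι where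
  faces := {ρ | ∃ v ∈ σ, ρ ∈ (star K {v}).faces}
  isRelLowerSet_faces := by
    rintro ρ ⟨v, hv, hρ⟩
    exact ⟨hρ.1, fun _ hsub hne => ⟨v, hv, ((star K {v}).isRelLowerSet_faces hρ).2 hsub hne⟩⟩

/-- The barycentric subdivision of `K`: the vertices are the nonempty faces of `K` and the faces are
the chains of these, ordered by inclusion. -/
def barycentricSubdivision (K : PreAbstractSimplicialComplex ι) :
    PreAbstractSimplicialComplex (Finset ι) where
  faces := {c | c.Nonempty ∧ (∀ s ∈ c, s ∈ K.faces) ∧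
    IsChain (fun s t : Finset ι => s ⊆ t) (c : Set (Finset ι))}
  isRelLowerSet_faces := by
    rintro c ⟨hc, hK, hch⟩
    exact ⟨hc, fun _ hsub hne => ⟨hne, fun s hs => hK s (hsub hs),
      hch.mono (Finset.coe_subset.mpr hsub)⟩⟩

end Complexes

/-- The boundary of the `(k-1)`-simplex on `k` vertices. -/
def boundarySimplex (k : ℕ) : PreAbstractSimplicialComplex (Fin k) where
  faces := {s | s.Nonempty ∧ s ≠ Finset.univ}
  isRelLowerSet_faces := by
    rintro s ⟨hs, hs'⟩
    refine ⟨hs, fun t hsub hne => ⟨hne, ?_⟩⟩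
    rintro rfl
    exact hs' (Finset.univ_subset_iff.mp hsub)

/-! ### The edgewise subdivision -/

/-- The simplex `R_{k,q} = {x : 0 ≤ x_1 ≤ ⋯ ≤ x_{k-1} ≤ q}` in `ℝ^(k-1)`. -/
def R (k q : ℕ) : Set (Fin (k - 1) → ℝ) :=
  {x | (∀ i, 0 ≤ x i) ∧ Monotone x ∧ ∀ i, x i ≤ q}

/-- The vertex set `W_{k,q}`: the integer points `0 ≤ v_1 ≤ ⋯ ≤ v_{k-1} ≤ q`. -/
def W (k q : ℕ) : Set (Fin (k - 1) → ℤ) :=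
  {v | (∀ i, 0 ≤ v i) ∧ Monotone v ∧ ∀ i, v i ≤ q}

/-- `π` is consistent with `v`: the value `i` stands before `i + 1` in the word of `π` whenever
`v_i = v_{i+1}`. -/
def Consistent (k : ℕ) (v : Fin (k - 1) → ℤ) (π : Equiv.Perm (Fin (k - 1))) : Prop :=
  ∀ i j : Fin (k - 1), (i : ℕ) + 1 = j → v i = v j → π.symm i < π.symm j

/-- The vertex `v^(j+1)` of `F(v, π)`, for `j = 0, …, k - 1`: the vector `v` plus the unit vectors
of the last `j` letters of the word of `π`. -/
def facetVertex (k : ℕ) (v : Fin (k - 1) → ℤ) (π : Equiv.Perm (Fin (k - 1))) (j : ℕ) :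
    Fin (k - 1) → ℤ :=
  v + ∑ m with k - 1 ≤ (m : Fin (k - 1)).val + j, Pi.single (π m) 1

/-- The vertex set `{v^(1), …, v^(k)}` of the simplex `F(v, π)`. -/
def F (k : ℕ) (v : Fin (k - 1) → ℤ) (π : Equiv.Perm (Fin (k - 1))) :
    Finset (Fin (k - 1) → ℤ) :=
  (Finset.range k).image (facetVertex k v π)

/-- `F(v, π)` is a facet of `T_{k,q}`: `π` is consistent with `v`, and the first vertex `v` and the
last vertex `v + (1, …, 1)` belong to `W_{k,q}`. -/
def IsFacet (k q : ℕ) (v : Fin (k - 1) → ℤ) (π : Equiv.Perm (Fin (k - 1))) : Prop :=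
  v ∈ W k q ∧ v + 1 ∈ W k q ∧ Consistent k v π

/-- The edgewise subdivision `T_{k,q}` of `R_{k,q}`; a simplex is given by its set of vertices. -/
def T (k q : ℕ) : PreAbstractSimplicialComplex (Fin (k - 1) → ℤ) where
  faces := {ρ | ρ.Nonempty ∧ ∃ v π, IsFacet k q v π ∧ ρ ⊆ F k v π}
  isRelLowerSet_faces := by
    rintro ρ ⟨hρ, v, π, h, hsub⟩
    exact ⟨hρ, fun _ hsub' hne => ⟨hne, v, π, h, subset_trans hsub' hsub⟩⟩

/-- The star cluster in `T_{k,q}` of the facet `F(v, Id)`. -/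
def SC (k q : ℕ) (v : Fin (k - 1) → ℤ) : PreAbstractSimplicialComplex (Fin (k - 1) → ℤ) :=
  starCluster (T k q) (F k v 1)

/-- The barycentric subdivision `Sd(∂Δ^{k-1})` of the boundary of the `(k-1)`-simplex. -/
def SdBoundary (k : ℕ) : PreAbstractSimplicialComplex (Finset (Fin k)) :=
  barycentricSubdivision (boundarySimplex k)

/-! ### Permutation statistics -/

/-- The faithful initial part `init(π) = min {t ≥ 1 : {π_1, …, π_t} = {1, …, t}}`; positions and
letters are numbered from `0` here. -/
def init {n : ℕ} (π : Equiv.Perm (Fin n)) : ℕ :=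
  sInf {t | 1 ≤ t ∧ t ≤ n ∧
    π '' {i : Fin n | (i : ℕ) < t} = {i : Fin n | (i : ℕ) < t}}

/-- The number of descents of `π`. -/
def des {n : ℕ} (π : Equiv.Perm (Fin n)) : ℕ :=
  Set.ncard {i : Fin n | ∃ j : Fin n, (i : ℕ) + 1 = j ∧ π j < π i}

/-- The vector `𝐡^k_t`: its entry at the (0-based) place `d` is the number of permutations `π` of
`k` letters with `init π = t` and `des π = d`. -/
def hRow (k t : ℕ) : Fin k → ℤ := fun d =>
  (Set.ncard {π : Equiv.Perm (Fin k) | init π = t ∧ des π = (d : ℕ)} : ℤ)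

/-- The `k × k` matrix `H_k`, with rows `𝐡^k_1, …, 𝐡^k_k`. -/
def H (k : ℕ) : Matrix (Fin k) (Fin k) ℤ := Matrix.of fun i => hRow k ((i : ℕ) + 1)

end EdgewiseSubdivision

end

/-
Adjacency of lattice points (their difference has all entries in `{0, 1}` or all in `{-1, 0}`)
makes the faces near an inner point the cliques. In suitable coordinates around the `i`-th vertex
of `F(v, Id)` the adjacent points are the proper subsets of `{0, …, k - 1}`, adjacency is
comparability, and the `j`-th vertex, for `j ≤ i`, is the initial segment of length `i - j`. So a
face of this star is a chain of proper subsets, and it lies in no earlier star if and only if none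
of the initial segments of lengths `1, …, i` is comparable with all its members.

A chain is the same as a permutation, listing its successive differences in increasing order, with
a set of cardinalities that contains the descents. The condition on the chain becomes `i < init π`,
so in the `f`-vector of the star cluster each `π` counts once for every `i < init π`, that is
`init π` times; for the subdivided boundary of the simplex each `π` counts once. The passage to the
`h`-vector leaves exactly the permutations with a given number of descents.
-/

namespace EdgewiseSubdivision

open Finset Function

section HVector

theorem alternating_sum_choose_of_le {n N : ℕ} (h : n ≤ N) :
    ∑ j ∈ range (N + 1), (-1 : ℤ) ^ j * n.choose j = if n = 0 then 1 else 0 := by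
  rw [eventually_constant_sum (N := n + 1) _ (by lia), Int.alternating_sum_range_choose]
  intro j hj
  rw [Nat.choose_eq_zero_of_lt hj, Nat.cast_zero, mul_zero]

theorem choose_mul_choose_sub {a d i s : ℕ} (had : a ≤ d) (his : i ≤ s) (hsd : s ≤ d) :
    (d - a).choose (d - i) * (d - i).choose (d - s) =
      (d - a).choose (d - s) * (s - a).choose (s - i) := by
  rcases lt_or_ge i a with hia | hai
  · rw [Nat.choose_eq_zero_of_lt (show d - a < d - i by lia), zero_mul]
    rcases lt_or_ge s a with hsa | has
    · rw [Nat.choose_eq_zero_of_lt (show d - a < d - s by lia), zero_mul]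
    · rw [Nat.choose_eq_zero_of_lt (show s - a < s - i by lia), mul_zero]
  · rw [Nat.choose_mul (by lia), show d - a - (d - s) = s - a by lia,
      show d - i - (d - s) = s - i by lia]

theorem sum_neg_one_pow_mul_choose_mul_choose {a d s : ℕ} (had : a ≤ d) (hsd : s ≤ d) :
    ∑ i ∈ range (s + 1),
      (-1 : ℤ) ^ (s - i) * (d - i).choose (d - s) * (d - a).choose (d - i) =
      if a = s then 1 else 0 := by
  calc _ = ∑ i ∈ range (s + 1),
          ((d - a).choose (d - s) : ℤ) * ((-1) ^ (s - i) * (s - a).choose (s - i)) := by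
        refine sum_congr rfl fun i hi => ?_
        have h := choose_mul_choose_sub had (mem_range_succ_iff.mp hi) hsd
        zify at h
        linear_combination (-1 : ℤ) ^ (s - i) * h
    _ = (d - a).choose (d - s) * ∑ j ∈ range (s + 1), (-1 : ℤ) ^ j * (s - a).choose j := by
        have h := sum_range_reflect (fun j => (-1 : ℤ) ^ j * (s - a).choose j) (s + 1)
        simp only [Nat.add_sub_cancel] at h
        rw [← mul_sum, h]
    _ = if a = s then 1 else 0 := by
        rw [alternating_sum_choose_of_le (Nat.sub_le s a)]
        rcases lt_trichotomy a s with has | rfl | hsa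
        · simp [has.ne, Nat.sub_ne_zero_of_lt has]
        · simp
        · simp [hsa.ne', Nat.choose_eq_zero_of_lt (show d - a < d - s by lia)]

variable {ι : Type*} {K : PreAbstractSimplicialComplex ι}

/- The hypothesis on the `f`-vector says that the `f`-polynomial is
`∑ x, g x * t ^ δ x * (t + 1) ^ (d - δ x)`, and the passage to the `h`-polynomial replaces `t + 1`
by `1`. -/
theorem hNum_eq_sum_of_fNum_eq {α : Type*} [Fintype α] {d : ℕ} (hd : rank K = d) (g : α → ℤ)
    {δ : α → ℕ} (hδ : ∀ x, δ x ≤ d)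
    (hf : ∀ m ≤ d, (fNum K m : ℤ) = ∑ x, g x * (d - δ x).choose (d - m)) {s : ℕ} (hs : s ≤ d) :
    hNum K s = ∑ x with δ x = s, g x := by
  rw [hNum, hd, if_pos hs]
  calc _ = ∑ i ∈ range (s + 1), ∑ x, g x *
          ((-1 : ℤ) ^ (s - i) * (d - i).choose (d - s) * (d - δ x).choose (d - i)) := by
        refine sum_congr rfl fun i hi => ?_
        rw [hf i ((mem_range_succ_iff.mp hi).trans hs), mul_sum]
        exact sum_congr rfl fun x _ => by ring
    _ = ∑ x, g x * if δ x = s then 1 else 0 := by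
        rw [sum_comm]
        refine sum_congr rfl fun x _ => ?_
        rw [← mul_sum, sum_neg_one_pow_mul_choose_mul_choose (hδ x) hs]
    _ = ∑ x with δ x = s, g x := by simp only [mul_ite, mul_one, mul_zero, sum_filter]

theorem fNum_eq_ncard {P : Finset ι → Prop} (hP : P ∅)
    (hK : ∀ ρ, ρ ∈ K.faces ↔ ρ.Nonempty ∧ P ρ) (m : ℕ) :
    fNum K m = {ρ | P ρ ∧ #ρ = m}.ncard := by
  rcases eq_or_ne m 0 with rfl | hm
  · have : {ρ | P ρ ∧ #ρ = 0} = {∅} := by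
      ext ρ
      simp only [card_eq_zero, Set.mem_ofPred_eq, Set.mem_singleton_iff]
      exact and_iff_right_of_imp fun h => h ▸ hP
    rw [this, Set.ncard_singleton, fNum, if_pos rfl]
  · rw [fNum, if_neg hm]
    congr 1
    ext ρ
    simp only [hK, Set.mem_ofPred_eq]
    refine and_congr_left fun hρ => and_iff_right ?_
    exact card_pos.mp (hρ ▸ Nat.pos_of_ne_zero hm)

theorem rank_eq_of_forall_card_le {d : ℕ} (hle : ∀ ρ ∈ K.faces, #ρ ≤ d) (hd : fNum K d ≠ 0) :
    rank K = d := by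
  have hupper : d ∈ upperBounds (Finset.card '' K.faces) := by
    rintro _ ⟨ρ, hρ, rfl⟩
    exact hle ρ hρ
  rcases Nat.eq_zero_or_pos d with rfl | hpos
  · exact Nat.eq_zero_of_le_zero (csSup_le' hupper)
  · rw [fNum, if_neg hpos.ne'] at hd
    obtain ⟨ρ, hρ, hcard⟩ := Set.nonempty_of_ncard_ne_zero hd
    exact (csSup_le' hupper).antisymm (le_csSup ⟨d, hupper⟩ ⟨ρ, hρ, hcard⟩)

end HVector

section Permutations

variable {n : ℕ}

/-- The initial segment `{0, …, t - 1}` of `Fin n`; it is all of `Fin n` when `n ≤ t`. -/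
def initSeg (n t : ℕ) : Finset (Fin n) := {i | (i : ℕ) < t}

@[simp]
theorem mem_initSeg {t : ℕ} {i : Fin n} : i ∈ initSeg n t ↔ (i : ℕ) < t := by
  simp [initSeg]

theorem card_initSeg {t : ℕ} (h : t ≤ n) : #(initSeg n t) = t := by
  rw [initSeg, Fin.card_filter_val_lt, min_eq_right h]

theorem initSeg_mono (n : ℕ) : Monotone (initSeg n) := fun _ _ hst _ hi =>
  mem_initSeg.mpr ((mem_initSeg.mp hi).trans_le hst)

theorem eq_initSeg_of_isLowerSet {B : Finset (Fin n)} (hB : IsLowerSet (B : Set (Fin n))) :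
    B = initSeg n #B := by
  have hcard : #B ≤ n := by simpa using card_le_univ B
  refine eq_of_subset_of_card_le (fun a ha => ?_) (card_initSeg hcard).le
  have hsub : initSeg n (a + 1) ⊆ B := fun b hb =>
    hB (Fin.le_def.mpr (Nat.lt_succ_iff.mp (mem_initSeg.mp hb))) ha
  simpa [card_initSeg a.isLt, Nat.succ_le_iff] using card_le_card hsub

theorem card_image_initSeg (π : Equiv.Perm (Fin n)) {t : ℕ} (ht : t ≤ n) :
    #((initSeg n t).image π) = t := by
  rw [card_image_of_injective _ π.injective, card_initSeg ht]

theorem image_initSeg_injOn (π : Equiv.Perm (Fin n)) :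
    Set.InjOn (fun t => (initSeg n t).image π) (Set.Iic n) := fun s hs t ht hst => by
  simpa [card_image_initSeg π hs, card_image_initSeg π ht] using congrArg Finset.card hst

theorem image_initSeg_mono (π : Equiv.Perm (Fin n)) : Monotone fun t => (initSeg n t).image π :=
  fun _ _ hst => image_subset_image (initSeg_mono n hst)

theorem image_initSeg_eq_of_forall_symm_lt {π : Equiv.Perm (Fin n)} {B : Finset (Fin n)}
    (hB : ∀ y ∈ B, ∀ x ∉ B, π.symm y < π.symm x) : (initSeg n #B).image π = B := by
  have hlower : IsLowerSet (B.image π.symm : Set (Fin n)) := by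
    intro a b hba ha
    obtain ⟨y, hy, rfl⟩ := mem_image.mp (mem_coe.mp ha)
    refine mem_coe.mpr (mem_image.mpr ⟨π b, ?_, π.symm_apply_apply b⟩)
    by_contra hb
    exact hba.not_gt (by simpa using hB y hy _ hb)
  rw [← card_image_of_injective B π.symm.injective, ← eq_initSeg_of_isLowerSet hlower, image_image]
  simp

/-- The descents of `π`, numbered by their second position: `d` is a descent if the letter at
position `d` is smaller than the one at position `d - 1`, positions starting from `0`. A block of
letters ending at the descent `d` is then an initial segment of length `d`. -/
def descSet (π : Equiv.Perm (Fin n)) : Finset ℕ :=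
  (univ.filter fun i : Fin n => ∃ j : Fin n, (i : ℕ) + 1 = j ∧ π j < π i).image
    fun i : Fin n => (i : ℕ) + 1

theorem mem_descSet {π : Equiv.Perm (Fin n)} {d : ℕ} :
    d ∈ descSet π ↔ ∃ i j : Fin n, (i : ℕ) + 1 = j ∧ π j < π i ∧ (j : ℕ) = d := by
  simp only [descSet, mem_image, mem_filter_univ]
  grind

theorem card_descSet (π : Equiv.Perm (Fin n)) : #(descSet π) = des π := by
  have hinj : Injective fun i : Fin n => (i : ℕ) + 1 := fun a b hab => Fin.ext (by simpa using hab)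
  rw [descSet, card_image_of_injective _ hinj, des, ← Set.ncard_coe_finset]
  simp

theorem descSet_subset (π : Equiv.Perm (Fin n)) : descSet π ⊆ Icc 1 (n - 1) := by
  intro d hd
  obtain ⟨i, j, hij, -, rfl⟩ := mem_descSet.mp hd
  exact mem_Icc.mpr ⟨by lia, by lia⟩

theorem des_le (π : Equiv.Perm (Fin n)) : des π ≤ n - 1 := by
  simpa [card_descSet] using card_le_card (descSet_subset π)

theorem lt_of_forall_notMem_descSet {π : Equiv.Perm (Fin n)} {a b : Fin n} (hab : a < b)
    (h : ∀ d, (a : ℕ) < d → d ≤ b → d ∉ descSet π) : π a < π b := by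
  have hmono : StrictMonoOn π (Set.Icc a b) := by
    refine strictMonoOn_of_lt_succ Set.ordConnected_Icc fun i hmax hi hsucc => ?_
    have hval : (i : ℕ) + 1 = (Order.succ i : Fin n) := by
      simpa using Order.covBy_succ_of_not_isMax hmax
    have hnot := h _ (by have := hi.1; lia) hsucc.2
    refine lt_of_le_of_ne (not_lt.mp fun hlt => hnot (mem_descSet.mpr ⟨i, _, hval, hlt, rfl⟩)) ?_
    exact fun heq => by have := congrArg Fin.val (π.injective heq); lia
  exact hmono (Set.left_mem_Icc.mpr hab.le) (Set.right_mem_Icc.mpr hab.le) hab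

theorem image_setOf_val_lt_eq_iff (π : Equiv.Perm (Fin n)) (t : ℕ) :
    π '' {i : Fin n | (i : ℕ) < t} = {i : Fin n | (i : ℕ) < t} ↔
      (initSeg n t).image π = initSeg n t := by
  simp [← coe_inj, initSeg]

theorem init_mem_Icc (hn : 1 ≤ n) (π : Equiv.Perm (Fin n)) : init π ∈ Icc 1 n := by
  have h := Nat.sInf_mem (s := {t | 1 ≤ t ∧ t ≤ n ∧
    π '' {i : Fin n | (i : ℕ) < t} = {i : Fin n | (i : ℕ) < t}}) ⟨n, hn, le_rfl, by simp⟩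
  exact mem_Icc.mpr ⟨h.1, h.2.1⟩

theorem lt_init_iff {i : ℕ} (hi : i < n) (π : Equiv.Perm (Fin n)) :
    i < init π ↔ ∀ t, 1 ≤ t → t ≤ i → (initSeg n t).image π ≠ initSeg n t := by
  have hne : {t | 1 ≤ t ∧ t ≤ n ∧
      π '' {i : Fin n | (i : ℕ) < t} = {i : Fin n | (i : ℕ) < t}}.Nonempty :=
    ⟨n, by lia, le_rfl, by simp⟩
  rw [init, Nat.lt_iff_add_one_le, le_csInf_iff (OrderBot.bddBelow _) hne]
  simp only [Set.mem_ofPred_eq, image_setOf_val_lt_eq_iff]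
  exact ⟨fun h t h1 hti ht => by have := h t ⟨h1, by lia, ht⟩; lia,
    fun h t ht => not_lt.mp fun hlt => h t ht.1 (by lia) ht.2.2⟩

end Permutations

section Chains

variable {n : ℕ}

/-- The number of members of the family `c` that avoid `l`. When `c` is a chain, its members are
the unions of the first levels of this function. -/
def avoidCount (c : Finset (Finset (Fin n))) (l : Fin n) : ℕ := #{A ∈ c | l ∉ A}

/-- The permutation encoding a chain `A₁ ⊂ ⋯ ⊂ Aₘ`: its word lists `A₁`, then `A₂ \ A₁`, and so on,
each block in increasing order. -/
def flagPerm (c : Finset (Finset (Fin n))) : Equiv.Perm (Fin n) := Tuple.sort (avoidCount c)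

/-- The chain of the sets of the first `d` letters of the word of `π`, for `d ∈ D`. -/
def flagOf (π : Equiv.Perm (Fin n)) (D : Finset ℕ) : Finset (Finset (Fin n)) :=
  D.image fun d => (initSeg n d).image π

variable {c : Finset (Finset (Fin n))} {π : Equiv.Perm (Fin n)} {D : Finset ℕ}

theorem flagPerm_eq_iff : flagPerm c = π ↔
    ∀ i j, i < j → avoidCount c (π i) < avoidCount c (π j) ∨
      avoidCount c (π i) = avoidCount c (π j) ∧ π i < π j := by
  rw [flagPerm, eq_comm, Tuple.eq_sort_iff]
  constructor
  · intro h i j hij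
    exact (h.1 hij.le).lt_or_eq.imp_right fun heq => ⟨heq, h.2 i j hij heq⟩
  · refine fun h => ⟨fun i j hij => ?_, fun i j hij heq => ?_⟩
    · rcases hij.eq_or_lt with rfl | hlt
      · exact le_rfl
      · exact (h i j hlt).elim le_of_lt fun h => h.1.le
    · exact ((h i j hij).resolve_left heq.not_lt).2

theorem flagPerm_symm_lt_iff {x y : Fin n} : (flagPerm c).symm x < (flagPerm c).symm y ↔
    avoidCount c x < avoidCount c y ∨ avoidCount c x = avoidCount c y ∧ x < y := by
  have h := flagPerm_eq_iff.mp (rfl : flagPerm c = flagPerm c)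
  have h₁ := h ((flagPerm c).symm x) ((flagPerm c).symm y)
  have h₂ := h ((flagPerm c).symm y) ((flagPerm c).symm x)
  have h₃ := (flagPerm c).symm.injective.eq_iff (a := x) (b := y)
  simp only [Equiv.apply_symm_apply] at h₁ h₂
  grind

theorem avoidCount_le {B : Finset (Fin n)} {x y : Fin n} (hB : ∀ A ∈ c, A ⊆ B ∨ B ⊆ A)
    (hy : y ∈ B) (hx : x ∉ B) : avoidCount c y ≤ avoidCount c x := by
  refine card_le_card fun A hA => ?_
  rw [mem_filter] at hA ⊢
  exact ⟨hA.1, fun hxA => (hB A hA.1).elim (fun h => hx (h hxA)) fun h => hA.2 (h hy)⟩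

theorem avoidCount_lt {B : Finset (Fin n)} {x y : Fin n}
    (hc : IsChain (· ⊆ ·) (c : Set (Finset (Fin n)))) (hB : B ∈ c) (hy : y ∈ B) (hx : x ∉ B) :
    avoidCount c y < avoidCount c x := by
  refine card_lt_card ((ssubset_iff_of_subset fun A hA => ?_).mpr ⟨B, ?_, ?_⟩)
  · rw [mem_filter] at hA ⊢
    exact ⟨hA.1, fun hxA => (hc.total hA.1 hB).elim (fun h => hx (h hxA)) fun h => hA.2 (h hy)⟩
  · exact mem_filter.mpr ⟨hB, hx⟩
  · simp [hy]

theorem image_initSeg_flagPerm_of_mem (hc : IsChain (· ⊆ ·) (c : Set (Finset (Fin n))))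
    {B : Finset (Fin n)} (hB : B ∈ c) : (initSeg n #B).image (flagPerm c) = B :=
  image_initSeg_eq_of_forall_symm_lt fun _ hy _ hx =>
    flagPerm_symm_lt_iff.mpr (Or.inl (avoidCount_lt hc hB hy hx))

theorem isChain_flagOf (π : Equiv.Perm (Fin n)) (D : Finset ℕ) :
    IsChain (· ⊆ ·) (flagOf π D : Set (Finset (Fin n))) := by
  rw [flagOf, coe_image]
  rintro _ ⟨d, -, rfl⟩ _ ⟨e, -, rfl⟩ -
  exact (le_total d e).imp (fun h => image_initSeg_mono π h) fun h => image_initSeg_mono π h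

theorem card_flagOf (π : Equiv.Perm (Fin n)) (hD : ∀ d ∈ D, d ≤ n) : #(flagOf π D) = #D :=
  card_image_of_injOn ((image_initSeg_injOn π).mono hD)

theorem image_card_flagOf (π : Equiv.Perm (Fin n)) (hD : ∀ d ∈ D, d ≤ n) :
    (flagOf π D).image Finset.card = D := by
  rw [flagOf, image_image]
  exact (image_congr fun d hd => card_image_initSeg π (hD d hd)).trans image_id

theorem flagOf_image_card_flagPerm (hc : IsChain (· ⊆ ·) (c : Set (Finset (Fin n)))) :
    flagOf (flagPerm c) (c.image Finset.card) = c := by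
  rw [flagOf, image_image]
  exact (image_congr fun B hB => image_initSeg_flagPerm_of_mem hc hB).trans image_id

theorem avoidCount_flagOf (π : Equiv.Perm (Fin n)) (hD : ∀ d ∈ D, d ≤ n) (i : Fin n) :
    avoidCount (flagOf π D) (π i) = #{d ∈ D | d ≤ (i : ℕ)} := by
  rw [avoidCount, flagOf, filter_image, card_image_of_injOn]
  · simp
  · exact (image_initSeg_injOn π).mono fun d hd => hD d (mem_filter.mp hd).1

theorem flagPerm_flagOf (hD : ∀ d ∈ D, d ≤ n) (hπ : descSet π ⊆ D) :
    flagPerm (flagOf π D) = π := by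
  refine flagPerm_eq_iff.mpr fun i j hij => ?_
  rw [avoidCount_flagOf π hD, avoidCount_flagOf π hD]
  have hsub : {d ∈ D | d ≤ (i : ℕ)} ⊆ {d ∈ D | d ≤ (j : ℕ)} :=
    monotone_filter_right D fun d _ hd => hd.trans (Fin.le_def.mp hij.le)
  refine (card_le_card hsub).lt_or_eq.imp_right fun heq => ⟨heq, ?_⟩
  refine lt_of_forall_notMem_descSet hij fun d hid hdj hd => hid.not_ge ?_
  have hmem : d ∈ {d ∈ D | d ≤ (j : ℕ)} := mem_filter.mpr ⟨hπ hd, hdj⟩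
  rw [← eq_of_subset_of_card_le hsub heq.ge] at hmem
  exact (mem_filter.mp hmem).2

theorem descSet_flagPerm_subset (hc : IsChain (· ⊆ ·) (c : Set (Finset (Fin n)))) :
    descSet (flagPerm c) ⊆ c.image Finset.card := by
  intro d hd
  obtain ⟨i, j, hij, hlt, rfl⟩ := mem_descSet.mp hd
  have hcount : avoidCount c (flagPerm c i) < avoidCount c (flagPerm c j) := by
    have h := flagPerm_eq_iff.mp (rfl : flagPerm c = flagPerm c) i j (Fin.lt_def.mpr (by lia))
    exact h.resolve_right fun h => hlt.not_gt h.2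
  obtain ⟨A, hA, hAi⟩ := not_subset.mp fun hsub => hcount.not_ge (card_le_card hsub)
  rw [mem_filter] at hA hAi
  have hiA : flagPerm c i ∈ A := by_contra fun h => hAi ⟨hA.1, h⟩
  refine mem_image.mpr ⟨A, hA.1, ?_⟩
  have hpos := image_initSeg_flagPerm_of_mem hc hA.1
  have hjA := hA.2
  rw [← hpos, (flagPerm c).injective.mem_finset_image, mem_initSeg] at hiA hjA
  lia

theorem isChain_insert_initSeg_iff (hc : IsChain (· ⊆ ·) (c : Set (Finset (Fin n)))) {t : ℕ}
    (ht : t ≤ n) : IsChain (· ⊆ ·) (insert (initSeg n t) (c : Set (Finset (Fin n)))) ↔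
      (initSeg n t).image (flagPerm c) = initSeg n t := by
  constructor
  · intro h
    have hB : ∀ A ∈ c, A ⊆ initSeg n t ∨ initSeg n t ⊆ A := fun A hA =>
      h.total (Set.mem_insert_of_mem _ hA) (Set.mem_insert _ _)
    conv_lhs => rw [← card_initSeg ht]
    refine image_initSeg_eq_of_forall_symm_lt fun y hy x hx => flagPerm_symm_lt_iff.mpr ?_
    refine (avoidCount_le hB hy hx).lt_or_eq.imp_right fun heq => ⟨heq, ?_⟩
    rw [mem_initSeg] at hy hx
    exact Fin.lt_def.mpr (by lia)
  · refine fun h => hc.insert fun A hA _ => ?_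
    have hpos := image_initSeg_flagPerm_of_mem hc hA
    rw [← h, ← hpos]
    exact (le_total t #A).imp (fun h => image_initSeg_mono _ h) fun h => image_initSeg_mono _ h

theorem lt_init_flagPerm_iff (hc : IsChain (· ⊆ ·) (c : Set (Finset (Fin n)))) {i : ℕ}
    (hi : i < n) : i < init (flagPerm c) ↔ ∀ t, 1 ≤ t → t ≤ i →
      ¬ IsChain (· ⊆ ·) (insert (initSeg n t) (c : Set (Finset (Fin n)))) := by
  rw [lt_init_iff hi]
  refine forall₃_congr fun t _ hti => ?_
  rw [isChain_insert_initSeg_iff hc (hti.trans hi.le)]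

open Classical in
/-- The chains of `m` subsets of `Fin n` with all cardinalities in `S`. -/
noncomputable def chains (n : ℕ) (S : Finset ℕ) (m : ℕ) : Finset (Finset (Finset (Fin n))) :=
  {c | IsChain (· ⊆ ·) (c : Set (Finset (Fin n))) ∧ (∀ A ∈ c, #A ∈ S) ∧ #c = m}

theorem mem_chains {S : Finset ℕ} {m : ℕ} : c ∈ chains n S m ↔
    IsChain (· ⊆ ·) (c : Set (Finset (Fin n))) ∧ (∀ A ∈ c, #A ∈ S) ∧ #c = m := by
  simp [chains]

theorem card_filter_superset_powersetCard {α : Type*} [DecidableEq α] {E S : Finset α}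
    (hES : E ⊆ S) {m : ℕ} (hm : m ≤ #S) :
    #{D ∈ powersetCard m S | E ⊆ D} = (#S - #E).choose (#S - m) := by
  rw [← card_sdiff_of_subset hES, ← card_powersetCard]
  refine card_nbij' (S \ ·) (S \ ·) (fun D hD => ?_) (fun D hD => ?_) (fun D hD => ?_)
    fun D hD => ?_
  · simp only [coe_filter, mem_powersetCard, Set.mem_ofPred_eq] at hD
    obtain ⟨⟨hDS, rfl⟩, hED⟩ := hD
    exact mem_powersetCard.mpr ⟨sdiff_subset_sdiff Subset.rfl hED, card_sdiff_of_subset hDS⟩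
  · obtain ⟨hD, hcard⟩ := mem_powersetCard.mp hD
    simp only [coe_filter, mem_powersetCard, Set.mem_ofPred_eq]
    refine ⟨⟨sdiff_subset, ?_⟩, fun e he => ?_⟩
    · rw [card_sdiff_of_subset (hD.trans sdiff_subset), hcard, Nat.sub_sub_self hm]
    · exact mem_sdiff.mpr ⟨hES he, fun heD => (mem_sdiff.mp (hD heD)).2 he⟩
  · simp only [coe_filter, mem_powersetCard, Set.mem_ofPred_eq] at hD
    exact Finset.sdiff_sdiff_eq_self hD.1.1
  · exact Finset.sdiff_sdiff_eq_self ((mem_powersetCard.mp hD).1.trans sdiff_subset)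

variable {S : Finset ℕ}

theorem card_filter_flagPerm_eq (hS : ∀ d ∈ S, d ≤ n) (m : ℕ) (π : Equiv.Perm (Fin n)) :
    #{c ∈ chains n S m | flagPerm c = π} = #{D ∈ powersetCard m S | descSet π ⊆ D} := by
  refine card_nbij' (fun c => c.image Finset.card) (flagOf π) (fun c hc => ?_) (fun D hD => ?_)
    (fun c hc => ?_) fun D hD => ?_
  · simp only [coe_filter, mem_chains, Set.mem_ofPred_eq] at hc
    obtain ⟨⟨hc, hcS, rfl⟩, rfl⟩ := hc
    have hsub : c.image Finset.card ⊆ S := image_subset_iff.mpr hcS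
    have hcard := card_flagOf (flagPerm c) fun d hd => hS d (hsub hd)
    rw [flagOf_image_card_flagPerm hc] at hcard
    simpa using ⟨⟨hsub, hcard.symm⟩, descSet_flagPerm_subset hc⟩
  · simp only [coe_filter, mem_powersetCard, Set.mem_ofPred_eq] at hD
    obtain ⟨⟨hDS, rfl⟩, hπ⟩ := hD
    have hD : ∀ d ∈ D, d ≤ n := fun d hd => hS d (hDS hd)
    refine mem_coe.mpr (mem_filter.mpr ⟨mem_chains.mpr ⟨isChain_flagOf π D, fun A hA => ?_,
      card_flagOf π hD⟩, flagPerm_flagOf hD hπ⟩)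
    exact hDS (image_card_flagOf π hD ▸ mem_image_of_mem _ hA)
  · simp only [coe_filter, mem_chains, Set.mem_ofPred_eq] at hc
    obtain ⟨hc, rfl⟩ := hc
    exact flagOf_image_card_flagPerm hc.1
  · simp only [coe_filter, mem_powersetCard, Set.mem_ofPred_eq] at hD
    exact image_card_flagOf π fun d hd => hS d (hD.1.1 hd)

theorem card_filter_chains (hS : Icc 1 (n - 1) ⊆ S) (hS' : ∀ d ∈ S, d ≤ n) {m : ℕ} (hm : m ≤ #S)
    (P : Equiv.Perm (Fin n) → Prop) [DecidablePred P] :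
    #{c ∈ chains n S m | P (flagPerm c)} = ∑ π with P π, (#S - des π).choose (#S - m) := by
  rw [card_eq_sum_card_fiberwise (f := flagPerm) (t := {π | P π})
    fun c hc => by simpa using (mem_filter.mp hc).2]
  refine sum_congr rfl fun π hπ => ?_
  have hfiber : {c ∈ {c ∈ chains n S m | P (flagPerm c)} | flagPerm c = π} =
      {c ∈ chains n S m | flagPerm c = π} := by
    rw [filter_filter]
    refine filter_congr fun c _ => and_iff_right_of_imp ?_
    rintro rfl
    exact (mem_filter.mp hπ).2
  rw [hfiber, card_filter_flagPerm_eq hS', ← card_descSet,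
    card_filter_superset_powersetCard ((descSet_subset π).trans hS) hm]

end Chains

section Adjacency

variable {ι : Type*} {x y : ι → ℤ}

/-- Adjacency of lattice points: the difference has all its entries in `{0, 1}`, or all its entries
in `{-1, 0}`. Every point is adjacent to itself. -/
def Adj (x y : ι → ℤ) : Prop := (x ≤ y ∧ y ≤ x + 1) ∨ (y ≤ x ∧ x ≤ y + 1)

theorem Adj.refl (x : ι → ℤ) : Adj x x := Or.inl ⟨le_rfl, le_add_of_nonneg_right zero_le_one⟩

theorem Adj.symm (h : Adj x y) : Adj y x := Or.symm h

instance : Std.Refl (Adj : (ι → ℤ) → (ι → ℤ) → Prop) := ⟨Adj.refl⟩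

instance : Std.Symm (Adj : (ι → ℤ) → (ι → ℤ) → Prop) := ⟨fun _ _ => Adj.symm⟩

theorem Adj.le_add_one (h : Adj x y) : x ≤ y + 1 :=
  h.elim (fun h => h.1.trans (le_add_of_nonneg_right zero_le_one)) And.right

theorem Adj.sub_le_sub_add_one (h : Adj x y) (a b : ι) : x a - y a ≤ x b - y b + 1 := by
  rcases h with h | h <;>
  · have ha := h.1 a
    have ha' := h.2 a
    have hb := h.1 b
    have hb' := h.2 b
    simp only [Pi.add_apply, Pi.one_apply] at ha' hb'
    lia

theorem pairwise_adj_insert_iff {s : Set (ι → ℤ)} :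
    (insert x s).Pairwise Adj ↔ s.Pairwise Adj ∧ ∀ y ∈ s, Adj x y := by
  rw [Set.pairwise_insert_of_symm]
  refine and_congr_right fun _ => forall₂_congr fun y _ => ⟨fun h => ?_, fun h _ => h⟩
  rcases eq_or_ne x y with rfl | hxy
  exacts [Adj.refl x, h hxy]

theorem exists_forall_le_of_pairwise_adj {s : Finset (ι → ℤ)} (hne : s.Nonempty)
    (hs : (s : Set (ι → ℤ)).Pairwise Adj) : ∃ u ∈ s, ∀ x ∈ s, u ≤ x ∧ x ≤ u + 1 := by
  obtain ⟨u, hu⟩ := s.exists_minimal hne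
  refine ⟨u, hu.1, fun x hx => ?_⟩
  have hux : Adj u x := Set.pairwise_iff_of_refl.mp hs hu.1 hx
  exact ⟨hux.elim And.left fun h => hu.2 hx h.1, hux.symm.le_add_one⟩

end Adjacency

section Facets

variable {k q : ℕ}

theorem facetVertex_apply (u : Fin (k - 1) → ℤ) (π : Equiv.Perm (Fin (k - 1))) (j : ℕ)
    (c : Fin (k - 1)) :
    facetVertex k u π j c = u c + if k - 1 ≤ (π.symm c : ℕ) + j then 1 else 0 := by
  have hc : ∀ m, c = π m ↔ π.symm c = m := fun m => π.symm_apply_eq.symm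
  rw [facetVertex, Pi.add_apply, Finset.sum_apply]
  simp only [Pi.single_apply, hc, sum_ite_eq, mem_filter_univ]

theorem facetVertex_one_apply (u : Fin (k - 1) → ℤ) (j : ℕ) (c : Fin (k - 1)) :
    facetVertex k u 1 j c = u c + if k - 1 ≤ (c : ℕ) + j then 1 else 0 :=
  facetVertex_apply u 1 j c

theorem facetVertex_mem_F (v : Fin (k - 1) → ℤ) (π : Equiv.Perm (Fin (k - 1))) {j : ℕ}
    (hj : j < k) : facetVertex k v π j ∈ F k v π :=
  mem_image_of_mem _ (mem_range.mpr hj)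

theorem pairwise_adj_F (u : Fin (k - 1) → ℤ) (π : Equiv.Perm (Fin (k - 1))) :
    (F k u π : Set (Fin (k - 1) → ℤ)).Pairwise Adj := by
  have hadj {a b : ℕ} (hab : a ≤ b) : Adj (facetVertex k u π a) (facetVertex k u π b) := by
    refine Or.inl ⟨fun c => ?_, fun c => ?_⟩ <;>
    · simp only [Pi.add_apply, Pi.one_apply, facetVertex_apply]
      split_ifs <;> lia
  rw [F, coe_image]
  rintro _ ⟨a, -, rfl⟩ _ ⟨b, -, rfl⟩ -
  exact (le_total a b).elim hadj fun h => (hadj h).symm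

/-- The set of coordinates on which `x` agrees with `u`. -/
def agreeSet {n : ℕ} (u x : Fin n → ℤ) : Finset (Fin n) := {c | x c = u c}

theorem mem_agreeSet {n : ℕ} {u x : Fin n → ℤ} {c : Fin n} : c ∈ agreeSet u x ↔ x c = u c :=
  mem_filter_univ c

theorem facetVertex_eq_of_image_initSeg {u x : Fin (k - 1) → ℤ} {π : Equiv.Perm (Fin (k - 1))}
    {t : ℕ} (ht : t ≤ k - 1) (hux : u ≤ x) (hxu : x ≤ u + 1)
    (hπ : (initSeg (k - 1) t).image π = agreeSet u x) : facetVertex k u π (k - 1 - t) = x := by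
  ext c
  have hc := Finset.ext_iff.mp hπ (π (π.symm c))
  rw [π.injective.mem_finset_image, mem_initSeg, mem_agreeSet, π.apply_symm_apply] at hc
  have hle := hux c
  have hle' := hxu c
  simp only [Pi.add_apply, Pi.one_apply] at hle'
  rw [facetVertex_apply]
  split_ifs <;> lia

section AgreeSet

variable {n : ℕ} {u : Fin n → ℤ} {s : Finset (Fin n → ℤ)}

theorem isChain_image_agreeSet (hs : (s : Set (Fin n → ℤ)).Pairwise Adj) (hu : ∀ x ∈ s, u ≤ x) :
    IsChain (· ⊆ ·) (s.image (agreeSet u) : Set (Finset (Fin n))) := by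
  have hsub {x y : Fin n → ℤ} (hx : x ∈ s) (hxy : x ≤ y) :
      agreeSet u y ⊆ agreeSet u x := fun c hc => by
    rw [mem_agreeSet] at hc ⊢
    exact (hc ▸ hxy c).antisymm (hu x hx c)
  rw [coe_image]
  rintro _ ⟨x, hx, rfl⟩ _ ⟨y, hy, rfl⟩ -
  exact (Set.pairwise_iff_of_refl.mp hs hx hy).symm.imp (fun h => hsub hy h.1) fun h => hsub hx h.1

theorem avoidCount_image_agreeSet_le (hu : ∀ x ∈ s, u ≤ x) (hs : ∀ x ∈ s, Monotone x) {a b : Fin n}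
    (hab : a ≤ b) (huab : u a = u b) :
    avoidCount (s.image (agreeSet u)) a ≤ avoidCount (s.image (agreeSet u)) b := by
  refine card_le_card fun A hA => ?_
  obtain ⟨hA, haA⟩ := mem_filter.mp hA
  refine mem_filter.mpr ⟨hA, ?_⟩
  obtain ⟨x, hx, rfl⟩ := mem_image.mp hA
  rw [mem_agreeSet] at haA ⊢
  have hua := hu x hx a
  have hxab := hs x hx hab
  lia

end AgreeSet

theorem consistent_flagPerm_image_agreeSet {u : Fin (k - 1) → ℤ} {s : Finset (Fin (k - 1) → ℤ)}
    (hu : ∀ x ∈ s, u ≤ x) (hs : ∀ x ∈ s, Monotone x) :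
    Consistent k u (flagPerm (s.image (agreeSet u))) := by
  intro a b hab huab
  have hlt : a < b := Fin.lt_def.mpr (by lia)
  exact flagPerm_symm_lt_iff.mpr
    ((avoidCount_image_agreeSet_le hu hs hlt.le huab).lt_or_eq.imp_right fun h => ⟨h, hlt⟩)

theorem subset_F_flagPerm_image_agreeSet (hk : 1 ≤ k) {u : Fin (k - 1) → ℤ}
    {s : Finset (Fin (k - 1) → ℤ)} (hs : (s : Set (Fin (k - 1) → ℤ)).Pairwise Adj)
    (hu : ∀ x ∈ s, u ≤ x ∧ x ≤ u + 1) : s ⊆ F k u (flagPerm (s.image (agreeSet u))) := by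
  intro x hx
  have hchain := isChain_image_agreeSet hs fun x hx => (hu x hx).1
  have hmem : agreeSet u x ∈ s.image (agreeSet u) := mem_image_of_mem _ hx
  have hcard : #(agreeSet u x) ≤ k - 1 := by
    simpa using card_le_univ (agreeSet u x)
  rw [← facetVertex_eq_of_image_initSeg hcard (hu x hx).1 (hu x hx).2
    (image_initSeg_flagPerm_of_mem hchain hmem)]
  exact facetVertex_mem_F u _ (by lia)

/-- The lattice points in the interior of `R k q`. -/
def IsInner (k q : ℕ) (w : Fin (k - 1) → ℤ) : Prop :=
  StrictMono w ∧ ∀ c, 1 ≤ w c ∧ w c + 1 ≤ q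

variable {w x : Fin (k - 1) → ℤ}

theorem IsInner.monotone_of_adj (hw : IsInner k q w) (h : Adj w x) : Monotone x := by
  refine monotone_iff_forall_lt.mpr fun a b hab => ?_
  have hwab := hw.1 hab
  have hdiff := h.sub_le_sub_add_one b a
  lia

theorem IsInner.mem_W_of_adj (hw : IsInner k q w) (h : Adj w x) : x ∈ W k q := by
  refine ⟨fun c => ?_, hw.monotone_of_adj h, fun c => ?_⟩
  · have hwx : w c ≤ x c + 1 := h.le_add_one c
    have := (hw.2 c).1
    lia
  · have hxw : x c ≤ w c + 1 := h.symm.le_add_one c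
    have := (hw.2 c).2
    lia

theorem exists_isFacet_of_pairwise_adj (hk : 1 ≤ k) (hw : IsInner k q w)
    {s : Finset (Fin (k - 1) → ℤ)} (hws : w ∈ s) (hs : (s : Set (Fin (k - 1) → ℤ)).Pairwise Adj) :
    ∃ u π, IsFacet k q u π ∧ s ⊆ F k u π := by
  have hadj : ∀ x ∈ s, Adj w x := fun x hx => Set.pairwise_iff_of_refl.mp hs hws hx
  obtain ⟨u, hus, hu⟩ := exists_forall_le_of_pairwise_adj ⟨w, hws⟩ hs
  have hw_adj : Adj w (u + 1) := Or.inl ⟨(hu w hws).2, add_le_add_left (hu w hws).1 1⟩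
  exact ⟨u, flagPerm (s.image (agreeSet u)), ⟨hw.mem_W_of_adj (hadj u hus), hw.mem_W_of_adj hw_adj,
    consistent_flagPerm_image_agreeSet (fun x hx => (hu x hx).1) fun x hx =>
      hw.monotone_of_adj (hadj x hx)⟩, subset_F_flagPerm_image_agreeSet hk hs hu⟩

theorem mem_star_T_iff (hk : 1 ≤ k) (hw : IsInner k q w) {ρ : Finset (Fin (k - 1) → ℤ)} :
    ρ ∈ (star (T k q) {w}).faces ↔
      ρ.Nonempty ∧ (insert w (ρ : Set (Fin (k - 1) → ℤ))).Pairwise Adj := by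
  constructor
  · rintro ⟨hρ, τ, ⟨-, u, π, -, hτ⟩, hwτ, hρτ⟩
    refine ⟨hρ, (pairwise_adj_F u π).mono (Set.insert_subset ?_ (coe_subset.mpr (hρτ.trans hτ)))⟩
    exact hτ (singleton_subset_iff.mp hwτ)
  · rintro ⟨hρ, h⟩
    rw [← coe_insert] at h
    obtain ⟨u, π, hfacet, hsub⟩ := exists_isFacet_of_pairwise_adj hk hw (mem_insert_self w ρ) h
    exact ⟨hρ, insert w ρ, ⟨insert_nonempty w ρ, u, π, hfacet, hsub⟩,
      singleton_subset_iff.mpr (mem_insert_self w ρ), subset_insert w ρ⟩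

theorem exists_pos_add_smul_mem_of_mem_interior {E : Type*} [AddCommGroup E] [Module ℝ E]
    [TopologicalSpace E] [ContinuousAdd E] [ContinuousSMul ℝ E] {s : Set E} {x : E}
    (hx : x ∈ interior s) (d : E) : ∃ ε > (0 : ℝ), x + ε • d ∈ s := by
  have hcont : Continuous fun ε : ℝ => x + ε • d := by fun_prop
  have hev : ∀ᶠ ε : ℝ in nhds 0, x + ε • d ∈ s :=
    hcont.continuousAt.eventually_mem (by simpa using mem_interior_iff_mem_nhds.mp hx)
  obtain ⟨ε, hmem, hε⟩ := ((hev.filter_mono nhdsWithin_le_nhds).and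
    (self_mem_nhdsWithin (s := Set.Ioi (0 : ℝ)))).exists
  exact ⟨ε, hε, hmem⟩

theorem isInner_of_mem_interior (hw : (fun i => (w i : ℝ)) ∈ interior (R k q)) :
    IsInner k q w := by
  have hmem := exists_pos_add_smul_mem_of_mem_interior hw
  refine ⟨fun a b hab => ?_, fun c => ⟨?_, ?_⟩⟩
  · obtain ⟨ε, hε, -, hmono, -⟩ := hmem fun c => -(c : ℝ)
    have hle := hmono hab.le
    have hlt : (a : ℝ) < (b : ℝ) := by exact_mod_cast hab
    simp only [Pi.add_apply, Pi.smul_apply, smul_eq_mul] at hle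
    exact_mod_cast (by nlinarith : (w a : ℝ) < w b)
  · obtain ⟨ε, hε, hnonneg, -⟩ := hmem fun _ => -1
    have hle := hnonneg c
    simp only [Pi.add_apply, Pi.smul_apply, smul_eq_mul] at hle
    exact_mod_cast (by linarith : (0 : ℝ) < w c)
  · obtain ⟨ε, hε, -, -, hbound⟩ := hmem fun _ => 1
    have hle := hbound c
    simp only [Pi.add_apply, Pi.smul_apply, smul_eq_mul] at hle
    exact_mod_cast (by linarith : (w c : ℝ) < q)

end Facets

section LocalCoordinates

variable {k : ℕ}

/-- The letter `c + i + 1` modulo `k`. For fixed `i` this labels the `k - 1` coordinates by the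
letters other than `i`. -/
def letter (i : Fin k) (c : Fin (k - 1)) : Fin k :=
  ⟨if (c : ℕ) + i + 1 < k then c + i + 1 else c + i + 1 - k, by split_ifs <;> lia⟩

theorem letter_ne (i : Fin k) (c : Fin (k - 1)) : letter i c ≠ i := by
  simp only [letter, ne_eq, Fin.ext_iff]
  split_ifs <;> lia

theorem letter_injective (i : Fin k) : Injective (letter i) := by
  intro c d hcd
  simp only [letter, Fin.ext_iff] at hcd ⊢
  split_ifs at hcd <;> lia

theorem exists_letter_eq {i l : Fin k} (h : l ≠ i) : ∃ c, letter i c = l := by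
  rw [ne_eq, Fin.ext_iff] at h
  refine ⟨⟨if (i : ℕ) < l then l - i - 1 else l + k - i - 1, by split_ifs <;> lia⟩, ?_⟩
  simp only [letter, Fin.ext_iff]
  split_ifs <;> lia

theorem exists_finset_letter (i : Fin k) (p : Prop) (P : Fin (k - 1) → Prop) :
    ∃ A : Finset (Fin k), (i ∈ A ↔ p) ∧ ∀ c, letter i c ∈ A ↔ P c := by
  classical
  refine ⟨univ.filter fun l => l = i ∧ p ∨ ∃ c, letter i c = l ∧ P c, ?_, fun c => ?_⟩
  · simp [letter_ne]
  · simp [letter_ne, (letter_injective i).eq_iff]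

/-- The lattice point obtained from `w` by subtracting the unit vectors whose coordinates have their
letter in `A`, and adding `(1, …, 1)` if `i ∈ A`. For `A ≠ univ` these are the points adjacent to
`w`. -/
def neighbor (w : Fin (k - 1) → ℤ) (i : Fin k) (A : Finset (Fin k)) : Fin (k - 1) → ℤ := fun c =>
  w c + (if i ∈ A then 1 else 0) - (if letter i c ∈ A then 1 else 0)

variable {w : Fin (k - 1) → ℤ} {i : Fin k} {A B : Finset (Fin k)}

theorem adj_neighbor_of_subset (h : A ⊆ B) : Adj (neighbor w i A) (neighbor w i B) := by
  have hi := @h i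
  by_cases hiAB : i ∈ B ∧ i ∉ A
  · refine Or.inl ⟨fun c => ?_, fun c => ?_⟩ <;>
    · have hc := @h (letter i c)
      simp only [neighbor, Pi.add_apply, Pi.one_apply]
      grind
  · refine Or.inr ⟨fun c => ?_, fun c => ?_⟩ <;>
    · have hc := @h (letter i c)
      simp only [neighbor, Pi.add_apply, Pi.one_apply]
      grind

theorem adj_neighbor_iff : Adj (neighbor w i A) (neighbor w i B) ↔ A ⊆ B ∨ B ⊆ A := by
  refine ⟨fun h => ?_, fun h => h.elim adj_neighbor_of_subset fun h =>
    (adj_neighbor_of_subset h).symm⟩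
  by_contra! hAB
  obtain ⟨l, hlA, hlB⟩ := not_subset.mp hAB.1
  obtain ⟨m, hmB, hmA⟩ := not_subset.mp hAB.2
  rcases eq_or_ne l i with rfl | hl
  · obtain ⟨c, rfl⟩ := exists_letter_eq (i := l) (l := m) (by rintro rfl; exact hmA hlA)
    have := h.le_add_one c
    simp [neighbor, *] at this
  obtain ⟨c, rfl⟩ := exists_letter_eq hl
  rcases eq_or_ne m i with rfl | hm
  · have := h.symm.le_add_one c
    simp [neighbor, *] at this
  · obtain ⟨d, rfl⟩ := exists_letter_eq hm
    have := h.sub_le_sub_add_one d c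
    simp only [neighbor, hlA, hlB, hmA, hmB, if_true, if_false] at this
    lia

theorem neighbor_injOn (w : Fin (k - 1) → ℤ) (i : Fin k) :
    Set.InjOn (neighbor w i) {A | A ≠ univ} := by
  have hsub {A B : Finset (Fin k)} (hB : B ≠ univ) (heq : neighbor w i A = neighbor w i B)
      (hAB : A ⊆ B) : A = B := by
    have hdiff (l : Fin k) : l ∈ B ∧ l ∉ A ↔ i ∈ B ∧ i ∉ A := by
      rcases eq_or_ne l i with rfl | hl
      · rfl
      · obtain ⟨c, rfl⟩ := exists_letter_eq hl
        have hi := @hAB i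
        have hc := @hAB (letter i c)
        have heqc := congrFun heq c
        simp only [neighbor] at heqc
        grind
    refine hAB.antisymm fun l hlB => by_contra fun hlA => hB (eq_univ_of_forall fun m => ?_)
    exact ((hdiff m).mpr ((hdiff l).mp ⟨hlB, hlA⟩)).1
  intro A hA B hB heq
  have hadj : Adj (neighbor w i A) (neighbor w i B) := heq ▸ Adj.refl _
  rcases adj_neighbor_iff.mp hadj with h | h
  exacts [hsub hB heq h, (hsub hA heq.symm h).symm]

theorem exists_neighbor_eq {x : Fin (k - 1) → ℤ} (i : Fin k) (h : Adj w x) :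
    ∃ A, A ≠ univ ∧ neighbor w i A = x := by
  by_cases hxw : x ≤ w
  · obtain ⟨A, hiA, hA⟩ := exists_finset_letter i False fun c => x c < w c
    refine ⟨A, fun hA => hiA.mp (hA ▸ mem_univ i), ?_⟩
    ext c
    have hx : x c ≤ w c := hxw c
    have hw : w c ≤ x c + 1 := h.le_add_one c
    simp only [neighbor, hiA, hA, if_false]
    split_ifs <;> lia
  · obtain ⟨A, hiA, hA⟩ := exists_finset_letter i True fun c => x c = w c
    refine ⟨A, fun hA' => hxw fun c => ((hA c).mp (hA' ▸ mem_univ _)).le, ?_⟩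
    ext c
    have hw : w c ≤ x c := (h.resolve_right fun h => hxw h.1).1 c
    have hx : x c ≤ w c + 1 := h.symm.le_add_one c
    simp only [neighbor, hiA, hA, if_true]
    split_ifs <;> lia

theorem neighbor_initSeg (v : Fin (k - 1) → ℤ) {t : ℕ} (ht : t ≤ i) :
    neighbor (facetVertex k v 1 i) i (initSeg k t) = facetVertex k v 1 (i - t) := by
  ext c
  have hi : i ∉ initSeg k t := by simpa using ht
  have hc : letter i c ∈ initSeg k t ↔ k ≤ (c : ℕ) + i + 1 ∧ (c : ℕ) + i + 1 < k + t := by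
    simp only [letter, mem_initSeg]
    split_ifs <;> lia
  simp only [neighbor, facetVertex_one_apply, hi, hc, if_false]
  split_ifs <;> lia

theorem pairwise_adj_image_neighbor_iff {c : Set (Finset (Fin k))} :
    (neighbor w i '' c).Pairwise Adj ↔ IsChain (· ⊆ ·) c := by
  constructor
  · intro h A hA B hB _
    exact adj_neighbor_iff.mp (Set.pairwise_iff_of_refl.mp h (Set.mem_image_of_mem _ hA)
      (Set.mem_image_of_mem _ hB))
  · rintro h _ ⟨A, hA, rfl⟩ _ ⟨B, hB, rfl⟩ -
    exact adj_neighbor_iff.mpr (h.total hA hB)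

end LocalCoordinates

section Counting

variable {k : ℕ}

theorem ne_univ_iff_card_mem_range {A : Finset (Fin k)} : A ≠ univ ↔ #A ∈ range k := by
  simpa using (card_lt_iff_ne_univ A).symm

/-- The sets of `m` lattice points that are faces of the star of the `j`-th vertex of `F(v, Id)`,
in the description of `mem_star_T_iff`; the empty set is included for `m = 0`. -/
def starSets (v : Fin (k - 1) → ℤ) (m : ℕ) (j : Fin k) : Set (Finset (Fin (k - 1) → ℤ)) :=
  {ρ | (insert (facetVertex k v 1 j) (ρ : Set (Fin (k - 1) → ℤ))).Pairwise Adj ∧ #ρ = m}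

variable {v : Fin (k - 1) → ℤ} {m : ℕ} {i j : Fin k} {c : Finset (Finset (Fin k))}

theorem image_neighbor_mem_starSets_iff (hc : ∀ A ∈ c, A ≠ univ) (hji : j ≤ i) :
    c.image (neighbor (facetVertex k v 1 i) i) ∈ starSets v m j ↔
      IsChain (· ⊆ ·) (insert (initSeg k (i - j)) (c : Set (Finset (Fin k)))) ∧ #c = m := by
  have hj : facetVertex k v 1 j = neighbor (facetVertex k v 1 i) i (initSeg k (i - j)) := by
    rw [neighbor_initSeg v (Nat.sub_le _ _), Nat.sub_sub_self hji]
  rw [starSets, Set.mem_ofPred_eq, card_image_of_injOn ((neighbor_injOn _ i).mono hc), hj,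
    coe_image, ← Set.image_insert_eq, pairwise_adj_image_neighbor_iff]

theorem image_neighbor_mem_disjointed_starSets_iff (hc : ∀ A ∈ c, A ≠ univ) :
    c.image (neighbor (facetVertex k v 1 i) i) ∈ disjointed (starSets v m) i ↔
      c ∈ chains k (range k) m ∧ i < init (flagPerm c) := by
  have hself : c.image (neighbor (facetVertex k v 1 i) i) ∈ starSets v m i ↔
      c ∈ chains k (range k) m := by
    have hinsert : IsChain (· ⊆ ·) (insert (initSeg k 0) (c : Set (Finset (Fin k)))) ↔
        IsChain (· ⊆ ·) (c : Set (Finset (Fin k))) := by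
      refine ⟨fun h => h.mono (Set.subset_insert _ _), fun h => h.insert fun A _ _ => Or.inl ?_⟩
      simp [initSeg]
    rw [image_neighbor_mem_starSets_iff hc le_rfl, Nat.sub_self, hinsert, mem_chains,
      and_iff_right fun A hA => ne_univ_iff_card_mem_range.mp (hc A hA)]
  rw [disjointed_eq_inter_compl, Set.mem_inter_iff, hself]
  simp only [Set.mem_iInter, Set.mem_compl_iff]
  refine and_congr_right fun hmem => ?_
  obtain ⟨hchain, -, hm⟩ := mem_chains.mp hmem
  rw [lt_init_flagPerm_iff hchain i.isLt]
  constructor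
  · intro h t ht hti hins
    refine h ⟨i - t, by lia⟩ (Fin.lt_def.mpr (by dsimp only; lia)) ?_
    rw [image_neighbor_mem_starSets_iff hc (Fin.le_def.mpr (Nat.sub_le _ _)), Nat.sub_sub_self hti]
    exact ⟨hins, hm⟩
  · intro h j hji hj
    exact h (i - j) (by lia) (Nat.sub_le _ _) ((image_neighbor_mem_starSets_iff hc hji.le).mp hj).1

theorem disjointed_starSets_eq_image (v : Fin (k - 1) → ℤ) (m : ℕ) (i : Fin k) :
    disjointed (starSets v m) i = (fun c : Finset (Finset (Fin k)) =>
      c.image (neighbor (facetVertex k v 1 i) i)) ''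
        ({c ∈ chains k (range k) m | i < init (flagPerm c)} : Finset _) := by
  ext ρ
  constructor
  · intro hρ
    have hstar : ρ ∈ starSets v m i := disjointed_subset _ i hρ
    have hadj := (pairwise_adj_insert_iff.mp hstar.1).2
    obtain ⟨c, hc, rfl⟩ := subset_set_image_iff.mp fun x hx => exists_neighbor_eq i (hadj x hx)
    exact ⟨c, mem_filter.mpr ((image_neighbor_mem_disjointed_starSets_iff hc).mp hρ), rfl⟩
  · rintro ⟨c, hc, rfl⟩
    have hc := mem_filter.mp (mem_coe.mp hc)
    exact (image_neighbor_mem_disjointed_starSets_iff fun A hA =>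
      ne_univ_iff_card_mem_range.mpr ((mem_chains.mp hc.1).2.1 A hA)).mpr hc

theorem ncard_disjointed_starSets (v : Fin (k - 1) → ℤ) (hm : m ≤ k) (i : Fin k) :
    (disjointed (starSets v m) i).ncard =
      ∑ π : Equiv.Perm (Fin k) with i < init π, (k - des π).choose (k - m) := by
  have hinj : Set.InjOn (fun c : Finset (Finset (Fin k)) =>
      c.image (neighbor (facetVertex k v 1 i) i))
        ({c ∈ chains k (range k) m | i < init (flagPerm c)} : Finset _) := by
    refine (image_injOn_powerset_of_injOn (s := univ.erase univ)
      ((neighbor_injOn _ i).mono fun A hA => ne_of_mem_erase hA)).mono fun c hc => ?_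
    have hcS := (mem_chains.mp (mem_filter.mp hc).1).2.1
    exact mem_powerset.mpr fun A hA =>
      mem_erase.mpr ⟨ne_univ_iff_card_mem_range.mpr (hcS A hA), mem_univ A⟩
  have hS : Icc 1 (k - 1) ⊆ range k := fun d hd => by
    have := mem_Icc.mp hd
    exact mem_range.mpr (by lia)
  rw [disjointed_starSets_eq_image, hinj.ncard_image, Set.ncard_coe_finset,
    card_filter_chains hS (fun d hd => (mem_range.mp hd).le) (by rwa [card_range])
      fun π => i < init π, card_range]

theorem ncard_iUnion_starSets (hk : 1 ≤ k) (v : Fin (k - 1) → ℤ) (hm : m ≤ k) :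
    (⋃ i, starSets v m i).ncard =
      ∑ π : Equiv.Perm (Fin k), init π * (k - des π).choose (k - m) := by
  have hfinite (i : Fin k) : (disjointed (starSets v m) i).Finite := by
    rw [disjointed_starSets_eq_image]
    exact (finite_toSet _).image _
  rw [← iUnion_disjointed, Set.ncard_iUnion_of_finite hfinite (disjoint_disjointed _),
    finsum_eq_sum_of_fintype]
  simp only [ncard_disjointed_starSets v hm, sum_filter]
  rw [sum_comm]
  refine sum_congr rfl fun π _ => ?_
  rw [← sum_filter, sum_const, smul_eq_mul, Fin.card_filter_val_lt,
    min_eq_right (mem_Icc.mp (init_mem_Icc hk π)).2]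

end Counting

section StarCluster

variable {k q : ℕ} {v : Fin (k - 1) → ℤ}

theorem mem_SC_iff (hk : 1 ≤ k) (hv : ∀ w ∈ F k v 1, IsInner k q w)
    {ρ : Finset (Fin (k - 1) → ℤ)} :
    ρ ∈ (SC k q v).faces ↔ ρ.Nonempty ∧ ∃ i : Fin k,
      (insert (facetVertex k v 1 i) (ρ : Set (Fin (k - 1) → ℤ))).Pairwise Adj := by
  constructor
  · rintro ⟨w, hw, hρ⟩
    obtain ⟨i, hi, rfl⟩ := mem_image.mp hw
    have h := (mem_star_T_iff hk (hv _ hw)).mp hρ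
    exact ⟨h.1, ⟨i, mem_range.mp hi⟩, h.2⟩
  · rintro ⟨hne, i, hi⟩
    have hw := facetVertex_mem_F v 1 i.isLt
    exact ⟨_, hw, (mem_star_T_iff hk (hv _ hw)).mpr ⟨hne, hi⟩⟩

theorem fNum_SC (hk : 1 ≤ k) (hv : ∀ w ∈ F k v 1, IsInner k q w) {m : ℕ} (hm : m ≤ k) :
    fNum (SC k q v) m = ∑ π : Equiv.Perm (Fin k), init π * (k - des π).choose (k - m) := by
  rw [← ncard_iUnion_starSets hk v hm, fNum_eq_ncard (by simpa using ⟨⟨0, hk⟩⟩)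
    fun ρ => mem_SC_iff hk hv]
  congr 1
  ext ρ
  simp [starSets]

theorem rank_SC (hk : 1 ≤ k) (hv : ∀ w ∈ F k v 1, IsInner k q w) : rank (SC k q v) = k := by
  refine rank_eq_of_forall_card_le ?_ ?_
  · rintro ρ ⟨w, -, -, τ, ⟨-, u, π, -, hτ⟩, -, hρτ⟩
    calc #ρ ≤ #(F k u π) := card_le_card (hρτ.trans hτ)
      _ ≤ k := card_image_le.trans (card_range k).le
  · rw [fNum_SC hk hv le_rfl]
    refine (sum_pos (fun π _ => ?_) univ_nonempty).ne'
    simpa using Nat.lt_of_succ_le (mem_Icc.mp (init_mem_Icc hk π)).1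

theorem hNum_SC (hk : 1 ≤ k) (hv : ∀ w ∈ F k v 1, IsInner k q w) {j : ℕ} (hj : j ≤ k) :
    hNum (SC k q v) j = ∑ π : Equiv.Perm (Fin k) with des π = j, (init π : ℤ) := by
  refine hNum_eq_sum_of_fNum_eq (rank_SC hk hv) _ (fun π => (des_le π).trans (Nat.sub_le k 1))
    (fun m hm => ?_) hj
  rw [fNum_SC hk hv hm]
  push_cast
  rfl

theorem hNum_SC_self (hk : 1 ≤ k) (hv : ∀ w ∈ F k v 1, IsInner k q w) :
    hNum (SC k q v) k = 0 := by
  rw [hNum_SC hk hv le_rfl, filter_false_of_mem, sum_empty]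
  exact fun π _ => ((des_le π).trans_lt (Nat.sub_one_lt_of_lt hk)).ne

end StarCluster

section SdBoundary

variable {k : ℕ}

theorem mem_boundarySimplex_iff {A : Finset (Fin k)} :
    A ∈ (boundarySimplex k).faces ↔ #A ∈ Icc 1 (k - 1) := by
  change A.Nonempty ∧ A ≠ univ ↔ _
  rw [ne_univ_iff_card_mem_range, ← card_pos, mem_range, mem_Icc]
  lia

theorem mem_SdBoundary_iff {c : Finset (Finset (Fin k))} :
    c ∈ (SdBoundary k).faces ↔ c.Nonempty ∧
      IsChain (· ⊆ ·) (c : Set (Finset (Fin k))) ∧ ∀ A ∈ c, #A ∈ Icc 1 (k - 1) := by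
  simp only [← mem_boundarySimplex_iff]
  exact and_congr_right fun _ => and_comm

theorem fNum_SdBoundary {m : ℕ} (hm : m ≤ k - 1) :
    fNum (SdBoundary k) m = ∑ π : Equiv.Perm (Fin k), (k - 1 - des π).choose (k - 1 - m) := by
  have hS : ∀ d ∈ Icc 1 (k - 1), d ≤ k := fun d hd => (mem_Icc.mp hd).2.trans (Nat.sub_le k 1)
  have hcard : #(Icc 1 (k - 1)) = k - 1 := by simp
  have hcount := card_filter_chains Subset.rfl hS (hm.trans_eq hcard.symm) fun _ => True
  rw [filter_true, filter_true, hcard] at hcount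
  rw [← hcount, fNum_eq_ncard (by simp) (fun c => mem_SdBoundary_iff), ← Set.ncard_coe_finset]
  congr 1
  ext c
  simp [mem_chains, and_assoc]

theorem rank_SdBoundary (k : ℕ) : rank (SdBoundary k) = k - 1 := by
  refine rank_eq_of_forall_card_le (fun c hc => ?_) ?_
  · obtain ⟨-, hchain, hc⟩ := mem_SdBoundary_iff.mp hc
    have hsub : c.image Finset.card ⊆ Icc 1 (k - 1) := image_subset_iff.mpr hc
    have hcard := card_flagOf (flagPerm c) fun d hd =>
      (mem_Icc.mp (hsub hd)).2.trans (Nat.sub_le k 1)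
    rw [flagOf_image_card_flagPerm hchain] at hcard
    simpa [hcard] using card_le_card hsub
  · rw [fNum_SdBoundary le_rfl]
    exact (sum_pos (fun π _ => by simp) univ_nonempty).ne'

theorem hNum_SdBoundary {j : ℕ} (hj : j ≤ k - 1) :
    hNum (SdBoundary k) j = #{π : Equiv.Perm (Fin k) | des π = j} := by
  rw [hNum_eq_sum_of_fNum_eq (rank_SdBoundary k) (fun _ => 1) des_le (fun m hm => ?_) hj]
  · simp
  · rw [fNum_SdBoundary hm]
    simp

end SdBoundary

section Rows

variable {k : ℕ}

theorem hRow_apply (t : ℕ) (d : Fin k) :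
    hRow k t d = #{π : Equiv.Perm (Fin k) | des π = d ∧ init π = t} := by
  rw [hRow, ← Set.ncard_coe_finset]
  simp [and_comm]

theorem sum_smul_hRow_apply (hk : 1 ≤ k) (g : ℕ → ℤ) (d : Fin k) :
    (∑ t ∈ Icc 1 k, g t • hRow k t) d =
      ∑ π : Equiv.Perm (Fin k) with des π = d, g (init π) := by
  rw [← sum_fiberwise_of_maps_to fun π _ => init_mem_Icc hk π, Finset.sum_apply]
  refine sum_congr rfl fun t _ => ?_
  rw [Pi.smul_apply, hRow_apply, filter_filter, smul_eq_mul, mul_comm, ← nsmul_eq_mul]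
  refine (sum_eq_card_nsmul fun π hπ => ?_).symm
  rw [(mem_filter.mp hπ).2.2]

theorem hNum_SdBoundary_eq_sum_hRow (hk : 1 ≤ k) :
    (fun j : Fin k => hNum (SdBoundary k) j) = ∑ t ∈ Icc 1 k, hRow k t := by
  ext d
  have h := sum_smul_hRow_apply hk (fun _ => 1) d
  simp only [one_smul] at h
  rw [h, hNum_SdBoundary (Nat.le_sub_one_of_lt d.isLt)]
  simp

theorem vecMul_H (k : ℕ) : (fun i : Fin k => ((i : ℕ) : ℤ) + 1) ᵥ* H k =
    ∑ t ∈ Icc 1 k, (t : ℤ) • hRow k t := by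
  rw [Matrix.vecMul_eq_sum, ← Ico_add_one_right_eq_Icc, sum_Ico_eq_sum_range, Nat.add_sub_cancel,
    ← Fin.sum_univ_eq_sum_range]
  refine sum_congr rfl fun i _ => ?_
  simp only [add_comm 1, Nat.cast_add, Nat.cast_one]
  rfl

theorem smul_sum_sub_sum_sub_smul {M : Type*} [AddCommGroup M] (k : ℕ) (f : ℕ → M) :
    (k : ℤ) • ∑ t ∈ Icc 1 k, f t - ∑ t ∈ Icc 1 (k - 1), ((k : ℤ) - t) • f t =
      ∑ t ∈ Icc 1 k, (t : ℤ) • f t := by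
  have hextend : ∑ t ∈ Icc 1 (k - 1), ((k : ℤ) - t) • f t =
      ∑ t ∈ Icc 1 k, ((k : ℤ) - t) • f t := by
    refine sum_subset (Icc_subset_Icc_right (Nat.sub_le k 1)) fun t ht ht' => ?_
    rw [mem_Icc] at ht ht'
    rw [show t = k by lia, sub_self, zero_smul]
  rw [hextend, smul_sum, ← sum_sub_distrib]
  exact sum_congr rfl fun t _ => by rw [← sub_smul, sub_sub_cancel]

variable {q : ℕ} {v : Fin (k - 1) → ℤ}

theorem hNum_SC_eq_sum_smul_hRow (hk : 1 ≤ k) (hv : ∀ w ∈ F k v 1, IsInner k q w) :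
    (fun j : Fin k => hNum (SC k q v) j) = ∑ t ∈ Icc 1 k, (t : ℤ) • hRow k t := by
  ext d
  rw [hNum_SC hk hv d.isLt.le, sum_smul_hRow_apply hk]

end Rows

end EdgewiseSubdivision

theorem mainTheorem9 (k q : ℕ) (hk : 1 ≤ k) (v : Fin (k - 1) → ℤ)
    (hF : EdgewiseSubdivision.IsFacet k q v 1)
    (hint : ∀ w ∈ EdgewiseSubdivision.F k v 1,
      (fun i => (w i : ℝ)) ∈ interior (EdgewiseSubdivision.R k q)) :
    -- `dim SC = k - 1`, so the `h`-vector has the entries `h_0, …, h_k`, the last of which is `0`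
    EdgewiseSubdivision.rank (EdgewiseSubdivision.SC k q v) = k ∧
    EdgewiseSubdivision.hNum (EdgewiseSubdivision.SC k q v) k = 0 ∧
    (fun j : Fin k => EdgewiseSubdivision.hNum (EdgewiseSubdivision.SC k q v) j) =
      (fun i : Fin k => ((i : ℕ) : ℤ) + 1) ᵥ* EdgewiseSubdivision.H k ∧
    (fun j : Fin k => EdgewiseSubdivision.hNum (EdgewiseSubdivision.SC k q v) j) =
      ∑ t ∈ Finset.Icc 1 k, (t : ℤ) • EdgewiseSubdivision.hRow k t ∧
    -- `dim Sd = k - 2`, so the `h`-vector of `Sd` has the entries `h_0, …, h_{k-1}`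
    EdgewiseSubdivision.rank (EdgewiseSubdivision.SdBoundary k) = k - 1 ∧
    (fun j : Fin k => EdgewiseSubdivision.hNum (EdgewiseSubdivision.SC k q v) j) =
      (k : ℤ) • (fun j : Fin k => EdgewiseSubdivision.hNum (EdgewiseSubdivision.SdBoundary k) j) -
        ∑ t ∈ Finset.Icc 1 (k - 1), ((k : ℤ) - t) • EdgewiseSubdivision.hRow k t ∧
    ∀ j ≤ k, EdgewiseSubdivision.hNum (EdgewiseSubdivision.SC k q v) j =
      ∑ π : Equiv.Perm (Fin k) with EdgewiseSubdivision.des π = j,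
        (EdgewiseSubdivision.init π : ℤ) := by
  open EdgewiseSubdivision in
  have hv : ∀ w ∈ F k v 1, IsInner k q w := fun w hw => isInner_of_mem_interior (hint w hw)
  have hrows := hNum_SC_eq_sum_smul_hRow hk hv
  refine ⟨rank_SC hk hv, hNum_SC_self hk hv, ?_, hrows, rank_SdBoundary k, ?_,
    fun j hj => hNum_SC hk hv hj⟩
  · rw [hrows, vecMul_H]
  · rw [hrows, hNum_SdBoundary_eq_sum_hRow hk, smul_sum_sub_sum_sub_smul]
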